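/- Let $0<\alpha\le 1$ and consider the spatially homogeneous inelastic Boltzmann equation for hard spheres on $\mathbb R^3$ with restitution coefficient $\alpha$, $\partial_t f=Q(f,f)$, where, for test functions $\varphi$, $$\int_{\mathbb R^3} Q(f,f)\,\varphi\,dv=\int_{\mathbb R^3}\int_{\mathbb R^3}\int_{\mathbb S^2_+}|(v-v_*)\cdot n|\,\bigl(\varphi(v')-\varphi(v)\bigr)\,dn\,f(dv_*)\,f(dv),\qquad v'=v-\tfrac{1+\alpha}{2}\bigl((v-v_*)\cdot n\bigr)n,$$ and $\mathbb S^2_+=\{n\in\mathbb S^2:(v_*-v)\cdot n\ge 0\}$. A weak solution is a family $(f_t)_{t\ge 0}$ of nonnegative Borel measures on $\mathbb R^3$ (in particular, $f_t=f(t,v)\,dv$ with a density $f(t,\cdot)\ge 0$) such that $\sup_{0\le t\le T}\int(1+|v|^2)\,f_t(dv)<\infty$ for every $T>0$ and, for every $\varphi\in C_c^\infty(\mathbb R^3)$, the function $t\mapsto\int Q(f_t,f_t)\varphi\,dv$ is integrable on $[0,t]$ for every $t\ge0$ and $$\int\varphi\,df_t=\int\varphi\,df_0+\int_0^t\int Q(f_\tau,f_\tau)\,\varphi\,dv\,d\tau\qquad\text{for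 all }t\ge 0.$$ Let $f_0\ge 0$ be a function on $\mathbb R^3$ with $$\int f_0\,dv=1,\qquad \int f_0\,v_i\,dv=0\ (i=1,2,3),\qquad \int f_0|v|^2\,dv=1,$$ and $f_0\in L^\infty_s$ for some $s>2$, that is, $\operatorname{ess\,sup}_v f_0(v)(1+|v|^2)^{s/2}<\infty$. Let $(f_t)_{t\ge0}$ be a weak solution with initial datum $f_0(v)\,dv$, and let $\mathcal E(t)=\int|v|^2\,f_t(dv)$ be its kinetic energy. Then its cooling time is infinite: $$\inf\{T\ge 0:\ \mathcal E(t)=0\ \text{for all } t>T\}=+\infty\qquad\text{and}\qquad \sup\{S\ge 0:\ \mathcal E(t)>0\ \text{for all } 0\le t<S\}=+\infty .$$ -/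

import Mathlib

open MeasureTheory Set
open scoped ENNReal ContDiff

noncomputable section

namespace InelasticBoltzmann

/-- The velocity space `ℝ³` with its Euclidean structure. -/
abbrev Vel : Type := EuclideanSpace ℝ (Fin 3)

/-- The unit sphere `𝕊²` of impact directions. -/
abbrev Dir : Type := Metric.sphere (0 : Vel) 1

/-- Membership in the weighted space `L^p_s(ℝ³)`, whose norm is the `L^p` norm of
`f(v) (1 + |v|²)^{s/2}`. -/
def MemWeightedLp (f : Vel → ℝ) (p : ℝ≥0∞) (s : ℝ) : Prop :=
  MemLp (fun v => f v * (1 + ‖v‖ ^ 2) ^ (s / 2)) p volume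

/-- The normalization of the initial datum: mass one, momentum zero, energy one. (The first and
third equations force the integrals to converge absolutely, because a Bochner integral that does
not converge has the value `0`; the second one then converges too.) -/
structure Normalized (f₀ : Vel → ℝ) : Prop where
  mass : ∫ v, f₀ v = 1
  momentum : ∀ i : Fin 3, ∫ v, f₀ v * v i = 0
  energy : ∫ v, f₀ v * ‖v‖ ^ 2 = 1

/-- The velocity `v' = v - β ((v - w) · n) n`, `β = (1 + α) / 2`, after an inelastic collision with
restitution coefficient `α` and impact direction `n`, of a particle that had velocity `v` and hit
a particle of velocity `w`. -/
def postVel (α : ℝ) (v w : Vel) (n : Dir) : Vel :=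
  v - ((1 + α) / 2 * inner ℝ (v - w) (n : Vel)) • (n : Vel)

/-- The hemisphere `𝕊²₊` of impact directions: the angle `θ` between `w - v` and `n` lies in
`[0, π/2]`. -/
def hemisphere (v w : Vel) : Set Dir := {n | 0 ≤ inner ℝ (w - v) (n : Vel)}

/-- The angular part of the weak collision operator for hard spheres,
`∫_{𝕊²₊} |(v - w) · n| (φ(v') - φ(v)) dn`, where `dn` is the surface measure of `𝕊²`
(total mass `4π`). -/
def angular (α : ℝ) (φ : Vel → ℝ) (v w : Vel) : ℝ :=
  ∫ n in hemisphere v w, |inner ℝ (v - w) (n : Vel)| * (φ (postVel α v w n) - φ v)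
    ∂(volume : Measure Vel).toSphere

/-- The weak form `∫ Q(f,f)(v) φ(v) dv = ∫∫∫ |(v - w) · n| (φ(v') - φ(v)) dn f(dw) f(dv)` of the
inelastic hard-sphere collision operator, for a velocity distribution `f`. -/
def weakCollision (α : ℝ) (f : Measure Vel) (φ : Vel → ℝ) : ℝ :=
  ∫ v, ∫ w, angular α φ v w ∂f ∂f

/-- Weak solutions on `[0, ∞)` of the spatially homogeneous inelastic Boltzmann equation
`∂ₜ f = Q(f,f)` for hard spheres. The velocity distribution at time `t` is a nonnegative measure
`f t`; a density `f(t,v)` is the case `f t = f(t,v) dv`. Measures are allowed so that the gas may a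
priori concentrate, in finite time, at zero velocity (`f t = δ₀` is a solution of zero energy).
Only `t ≥ 0` matters. -/
structure IsWeakSolution (α : ℝ) (f : ℝ → Measure Vel) : Prop where
  /-- Mass and energy are finite, locally uniformly in time. -/
  moments : ∀ T : ℝ, ∃ C : ℝ, ∀ t ∈ Icc 0 T,
    ∫⁻ v, ENNReal.ofReal (1 + ‖v‖ ^ 2) ∂(f t) ≤ ENNReal.ofReal C
  integrable : ∀ φ : Vel → ℝ, ContDiff ℝ ∞ φ → HasCompactSupport φ → ∀ t : ℝ, 0 ≤ t →
    IntervalIntegrable (fun τ => weakCollision α (f τ) φ) volume 0 t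
  /-- The equation, tested with `φ ∈ C_c^∞(ℝ³)` and integrated in time. -/
  equation : ∀ φ : Vel → ℝ, ContDiff ℝ ∞ φ → HasCompactSupport φ → ∀ t : ℝ, 0 ≤ t →
    ∫ v, φ v ∂(f t) = ∫ v, φ v ∂(f 0) + ∫ τ in (0 : ℝ)..t, weakCollision α (f τ) φ

/-- The total kinetic energy `∫ |v|² f(dv)`. -/
def energy (f : Measure Vel) : ℝ≥0∞ := ∫⁻ v, ENNReal.ofReal (‖v‖ ^ 2) ∂f

/-- The cooling time `inf {T ≥ 0 : 𝓔(t) = 0 for all t > T}`, with `inf ∅ = ∞`. -/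
def coolingTime (f : ℝ → Measure Vel) : ℝ≥0∞ :=
  sInf (ENNReal.ofReal '' {T : ℝ | 0 ≤ T ∧ ∀ t : ℝ, T < t → energy (f t) = 0})

/-- The second expression for the cooling time, `sup {S ≥ 0 : 𝓔(t) > 0 for all 0 ≤ t < S}`. -/
def coolingTime' (f : ℝ → Measure Vel) : ℝ≥0∞ :=
  sSup (ENNReal.ofReal '' {S : ℝ | 0 ≤ S ∧ ∀ t : ℝ, 0 ≤ t → t < S → 0 < energy (f t)})

end InelasticBoltzmann

end

/-!
Concentration at zero velocity can be excluded by a soft argument: collisions never create an atom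
at the origin. Testing the equation with the indicator `g` of `{v | v ≠ 0}` gives a collision term
which is nonnegative, because `g(v') < g(v)` means `v ≠ 0` and `v' = 0`, which for given `v`, `w`
forces the impact direction `n` to be parallel to `v`; these directions are negligible for the
surface measure (`toSphere_span_eq_zero`, `weakCollision_indicator_nonneg`). Hence
`f_t({v ≠ 0}) ≥ f_0({v ≠ 0})`, and the right-hand side is one since `f_0` has a density and mass one.
A distribution that charges `{v ≠ 0}` has positive energy.

The function `g` is not an admissible test function, but it is a pointwise limit of smooth compactly
supported functions with values in `[0, 1]` (`puncturedCutoff`). The angular integral of such a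
function is at most a constant times `|v - w|`, hence at most a constant times
`(1 + |v|²) (1 + |w|²)`, and the bound on mass and energy allows dominated convergence in all three
collision variables (`tendsto_weakCollision`) and in time.
-/

open Filter Topology
open scoped Pointwise

noncomputable section

namespace InelasticBoltzmann

/-! ### The angular integral -/

/-- The surface measure of the unit sphere. -/
abbrev surface : Measure Dir := (volume : Measure Vel).toSphere

lemma measurableSet_hemisphere (v w : Vel) : MeasurableSet (hemisphere v w) :=
  (isClosed_le continuous_const (by fun_prop)).measurableSet

/-- A line meets the sphere in a negligible set, as the cone over that set
lies in a proper subspace. -/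
lemma toSphere_span_eq_zero (v : Vel) :
    surface {n : Dir | (n : Vel) ∈ Submodule.span ℝ {v}} = 0 := by
  have hclosed : IsClosed {n : Dir | (n : Vel) ∈ Submodule.span ℝ {v}} :=
    (Submodule.closed_of_finiteDimensional (Submodule.span ℝ {v})).preimage continuous_subtype_val
  rw [Measure.toSphere_apply' _ hclosed.measurableSet]
  have hne : Submodule.span ℝ {v} ≠ ⊤ := by
    intro h
    have h1 := finrank_span_le_card (R := ℝ) ({v} : Set Vel)
    rw [h, finrank_top, finrank_euclideanSpace_fin] at h1
    simp at h1
  have h0 := Measure.addHaar_submodule (volume : Measure Vel) _ hne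
  rw [measure_mono_null _ h0, mul_zero]
  rintro _ ⟨r, -, _, ⟨n, hn, rfl⟩, rfl⟩
  exact Submodule.smul_mem _ r hn

lemma abs_inner_dir_le (u : Vel) (n : Dir) : |inner ℝ u (n : Vel)| ≤ ‖u‖ := by
  simpa using abs_real_inner_le_norm u (n : Vel)

/-- The weight `(1 + |v|²) (1 + |w|²)` bounds the relative velocity, and its `f ⊗ f`-integral is the
square of the sum of mass and energy. -/
lemma norm_sub_le_weight (v w : Vel) : ‖v - w‖ ≤ (1 + ‖v‖ ^ 2) * (1 + ‖w‖ ^ 2) := by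
  have h := norm_sub_le v w
  nlinarith [sq_nonneg (‖v‖ - 1 / 2), sq_nonneg (‖w‖ - 1 / 2),
    mul_nonneg (sq_nonneg ‖v‖) (sq_nonneg ‖w‖)]

lemma abs_collision_integrand_le {φ : Vel → ℝ} (hφ : ∀ x, φ x ∈ Icc (0 : ℝ) 1) (α : ℝ)
    (v w : Vel) (n : Dir) :
    ‖|inner ℝ (v - w) (n : Vel)| * (φ (postVel α v w n) - φ v)‖ ≤ ‖v - w‖ := by
  rw [Real.norm_eq_abs, abs_mul, abs_abs]
  have h1 : |φ (postVel α v w n) - φ v| ≤ 1 := by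
    have ha := hφ (postVel α v w n)
    have hb := hφ v
    rw [abs_le]
    constructor <;> linarith [ha.1, ha.2, hb.1, hb.2]
  exact (mul_le_mul (abs_inner_dir_le _ _) h1 (abs_nonneg _) (norm_nonneg _)).trans_eq (mul_one _)

lemma norm_angular_le {φ : Vel → ℝ} (hφ : ∀ x, φ x ∈ Icc (0 : ℝ) 1) (α : ℝ) (v w : Vel) :
    ‖angular α φ v w‖ ≤ surface.real univ * ((1 + ‖v‖ ^ 2) * (1 + ‖w‖ ^ 2)) := by
  calc ‖angular α φ v w‖ ≤ ‖v - w‖ * surface.real (hemisphere v w) :=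
        norm_setIntegral_le_of_norm_le_const (measure_lt_top _ _)
          fun n _ => abs_collision_integrand_le hφ α v w n
    _ ≤ ((1 + ‖v‖ ^ 2) * (1 + ‖w‖ ^ 2)) * surface.real univ :=
        mul_le_mul (norm_sub_le_weight v w) (measureReal_mono (subset_univ _))
          measureReal_nonneg (by positivity)
    _ = _ := mul_comm _ _

lemma continuous_postVel (α : ℝ) :
    Continuous fun p : (Vel × Vel) × Dir => postVel α p.1.1 p.1.2 p.2 := by
  unfold postVel
  fun_prop

lemma stronglyMeasurable_angular {φ : Vel → ℝ} (hφ : Continuous φ) (α : ℝ) :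
    StronglyMeasurable fun p : Vel × Vel => angular α φ p.1 p.2 := by
  have hcont : Continuous fun p : (Vel × Vel) × Dir =>
      |inner ℝ (p.1.1 - p.1.2) (p.2 : Vel)| * (φ (postVel α p.1.1 p.1.2 p.2) - φ p.1.1) := by
    have h : Continuous fun p : (Vel × Vel) × Dir => |inner ℝ (p.1.1 - p.1.2) (p.2 : Vel)| := by
      fun_prop
    exact h.mul ((hφ.comp (continuous_postVel α)).sub (hφ.comp (by fun_prop)))
  have hset : MeasurableSet {p : (Vel × Vel) × Dir | 0 ≤ inner ℝ (p.1.2 - p.1.1) (p.2 : Vel)} :=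
    (isClosed_le continuous_const (by fun_prop)).measurableSet
  have h := (hcont.stronglyMeasurable.indicator hset).integral_prod_right' (ν := surface)
  convert h using 1
  ext ⟨v, w⟩
  exact (integral_indicator (measurableSet_hemisphere v w)).symm

lemma tendsto_angular {φ : ℕ → Vel → ℝ} {g : Vel → ℝ} (hc : ∀ k, Continuous (φ k))
    (hφ : ∀ k x, φ k x ∈ Icc (0 : ℝ) 1) (hlim : ∀ x, Tendsto (φ · x) atTop (𝓝 (g x)))
    (α : ℝ) (v w : Vel) :
    Tendsto (fun k => angular α (φ k) v w) atTop (𝓝 (angular α g v w)) := by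
  refine tendsto_integral_of_dominated_convergence (fun _ => ‖v - w‖) (fun k => ?_)
    (integrable_const _) (fun k => .of_forall (abs_collision_integrand_le (hφ k) α v w))
    (.of_forall fun n => ((hlim _).sub (hlim _)).const_mul _)
  have h1 := (hc k).comp ((continuous_postVel α).comp (Continuous.prodMk_right (v, w)))
  have h2 : Continuous fun n : Dir => |inner ℝ (v - w) (n : Vel)| := by fun_prop
  exact (h2.mul (h1.sub continuous_const)).aestronglyMeasurable

/-! ### The collision operator on bounded test functions -/

lemma isFiniteMeasure_of_moment {μ : Measure Vel} {C : ℝ}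
    (hμ : ∫⁻ v, ENNReal.ofReal (1 + ‖v‖ ^ 2) ∂μ ≤ ENNReal.ofReal C) : IsFiniteMeasure μ := by
  refine ⟨lt_of_le_of_lt ?_ (hμ.trans_lt ENNReal.ofReal_lt_top)⟩
  rw [← lintegral_one]
  refine lintegral_mono fun v => ?_
  rw [← ENNReal.ofReal_one]
  exact ENNReal.ofReal_le_ofReal (by nlinarith [sq_nonneg ‖v‖])

lemma integrable_weight {μ : Measure Vel} {C : ℝ}
    (hμ : ∫⁻ v, ENNReal.ofReal (1 + ‖v‖ ^ 2) ∂μ ≤ ENNReal.ofReal C) :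
    Integrable (fun v : Vel => 1 + ‖v‖ ^ 2) μ := by
  refine ⟨Continuous.aestronglyMeasurable (by fun_prop), ?_⟩
  rw [hasFiniteIntegral_iff_ofReal (.of_forall fun v => by positivity)]
  exact hμ.trans_lt ENNReal.ofReal_lt_top

lemma integral_weight_le {μ : Measure Vel} {C : ℝ}
    (hμ : ∫⁻ v, ENNReal.ofReal (1 + ‖v‖ ^ 2) ∂μ ≤ ENNReal.ofReal C) :
    ∫ v, (1 + ‖v‖ ^ 2) ∂μ ≤ max C 0 := by
  rw [integral_eq_lintegral_of_nonneg_ae (.of_forall fun v => by positivity)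
    (Continuous.aestronglyMeasurable (by fun_prop))]
  exact (ENNReal.toReal_mono ENNReal.ofReal_ne_top hμ).trans_eq (ENNReal.toReal_ofReal' )

lemma norm_integral_angular_le {μ : Measure Vel} {C : ℝ}
    (hμ : ∫⁻ v, ENNReal.ofReal (1 + ‖v‖ ^ 2) ∂μ ≤ ENNReal.ofReal C)
    {φ : Vel → ℝ} (hφ : ∀ x, φ x ∈ Icc (0 : ℝ) 1) (α : ℝ) (v : Vel) :
    ‖∫ w, angular α φ v w ∂μ‖ ≤ surface.real univ * max C 0 * (1 + ‖v‖ ^ 2) := by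
  calc ‖∫ w, angular α φ v w ∂μ‖
      ≤ ∫ w, surface.real univ * ((1 + ‖v‖ ^ 2) * (1 + ‖w‖ ^ 2)) ∂μ :=
        norm_integral_le_of_norm_le (((integrable_weight hμ).const_mul _).const_mul _)
          (.of_forall fun w => norm_angular_le hφ α v w)
    _ = surface.real univ * (1 + ‖v‖ ^ 2) * ∫ w, (1 + ‖w‖ ^ 2) ∂μ := by
        rw [integral_const_mul, integral_const_mul, mul_assoc]
    _ ≤ surface.real univ * (1 + ‖v‖ ^ 2) * max C 0 := by
        gcongr
        exact integral_weight_le hμ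
    _ = _ := by ring

lemma norm_weakCollision_le {μ : Measure Vel} {C : ℝ}
    (hμ : ∫⁻ v, ENNReal.ofReal (1 + ‖v‖ ^ 2) ∂μ ≤ ENNReal.ofReal C)
    {φ : Vel → ℝ} (hφ : ∀ x, φ x ∈ Icc (0 : ℝ) 1) (α : ℝ) :
    ‖weakCollision α μ φ‖ ≤ surface.real univ * max C 0 * max C 0 := by
  calc ‖weakCollision α μ φ‖
      ≤ ∫ v, surface.real univ * max C 0 * (1 + ‖v‖ ^ 2) ∂μ :=
        norm_integral_le_of_norm_le ((integrable_weight hμ).const_mul _)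
          (.of_forall fun v => norm_integral_angular_le hμ hφ α v)
    _ = surface.real univ * max C 0 * ∫ v, (1 + ‖v‖ ^ 2) ∂μ := integral_const_mul _ _
    _ ≤ _ := by
        gcongr
        exact integral_weight_le hμ

lemma tendsto_weakCollision {μ : Measure Vel} {C : ℝ}
    (hμ : ∫⁻ v, ENNReal.ofReal (1 + ‖v‖ ^ 2) ∂μ ≤ ENNReal.ofReal C)
    {φ : ℕ → Vel → ℝ} {g : Vel → ℝ} (hc : ∀ k, Continuous (φ k))
    (hφ : ∀ k x, φ k x ∈ Icc (0 : ℝ) 1) (hlim : ∀ x, Tendsto (φ · x) atTop (𝓝 (g x))) (α : ℝ) :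
    Tendsto (fun k => weakCollision α μ (φ k)) atTop (𝓝 (weakCollision α μ g)) := by
  have := isFiniteMeasure_of_moment hμ
  refine tendsto_integral_of_dominated_convergence _
    (fun k => (stronglyMeasurable_angular (hc k) α).integral_prod_right.aestronglyMeasurable)
    ((integrable_weight hμ).const_mul _)
    (fun k => .of_forall (norm_integral_angular_le hμ (hφ k) α)) (.of_forall fun v => ?_)
  exact tendsto_integral_of_dominated_convergence _
    (fun k => ((stronglyMeasurable_angular (hc k) α).comp_measurable
      measurable_prodMk_left).aestronglyMeasurable)
    (((integrable_weight hμ).const_mul _).const_mul _)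
    (fun k => .of_forall (norm_angular_le (hφ k) α v))
    (.of_forall fun w => tendsto_angular hc hφ hlim α v w)

/-- The weak equation extends from `C_c^∞` to pointwise limits of test functions with values in
`[0, 1]`. -/
lemma IsWeakSolution.equation_of_tendsto {α : ℝ} {f : ℝ → Measure Vel} (hf : IsWeakSolution α f)
    {φ : ℕ → Vel → ℝ} {g : Vel → ℝ} (hsmooth : ∀ k, ContDiff ℝ ∞ (φ k))
    (hsupp : ∀ k, HasCompactSupport (φ k)) (hφ : ∀ k x, φ k x ∈ Icc (0 : ℝ) 1)
    (hlim : ∀ x, Tendsto (φ · x) atTop (𝓝 (g x))) {t : ℝ} (ht : 0 ≤ t) :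
    ∫ v, g v ∂(f t) = ∫ v, g v ∂(f 0) + ∫ τ in (0 : ℝ)..t, weakCollision α (f τ) g := by
  obtain ⟨C, hC⟩ := hf.moments t
  have hc k : Continuous (φ k) := (hsmooth k).continuous
  have hint τ (hτ : τ ∈ Icc 0 t) :
      Tendsto (fun k => ∫ v, φ k v ∂(f τ)) atTop (𝓝 (∫ v, g v ∂(f τ))) := by
    have := isFiniteMeasure_of_moment (hC τ hτ)
    refine tendsto_integral_of_dominated_convergence (fun _ => 1)
      (fun k => (hc k).aestronglyMeasurable) (integrable_const _)
      (fun k => .of_forall fun x => ?_) (.of_forall hlim)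
    rw [Real.norm_eq_abs, abs_of_nonneg (hφ k x).1]
    exact (hφ k x).2
  have hmem : ∀ τ ∈ uIoc 0 t, τ ∈ Icc 0 t := fun τ hτ => by
    rw [uIoc_of_le ht] at hτ
    exact Ioc_subset_Icc_self hτ
  have htime : Tendsto (fun k => ∫ τ in (0 : ℝ)..t, weakCollision α (f τ) (φ k)) atTop
      (𝓝 (∫ τ in (0 : ℝ)..t, weakCollision α (f τ) g)) :=
    intervalIntegral.tendsto_integral_filter_of_dominated_convergence
      (fun _ => surface.real univ * max C 0 * max C 0)
      (.of_forall fun k =>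
        (intervalIntegrable_iff.1 (hf.integrable _ (hsmooth k) (hsupp k) t ht)).1)
      (.of_forall fun k => .of_forall fun τ hτ =>
        norm_weakCollision_le (hC τ (hmem τ hτ)) (hφ k) α)
      intervalIntegrable_const
      (.of_forall fun τ hτ => tendsto_weakCollision (hC τ (hmem τ hτ)) hc hφ hlim α)
  refine tendsto_nhds_unique (hint t ⟨ht, le_rfl⟩) ?_
  simp only [fun k => hf.equation _ (hsmooth k) (hsupp k) t ht]
  exact (hint 0 ⟨le_rfl, ht⟩).add htime

/-! ### Nonzero velocities -/

lemma angular_indicator_nonneg (α : ℝ) (v w : Vel) :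
    0 ≤ angular α (indicator {0}ᶜ 1) v w := by
  refine integral_nonneg_of_ae (ae_restrict_of_ae ?_)
  have hnull : ∀ᵐ n : Dir ∂surface, (n : Vel) ∉ Submodule.span ℝ {v} := by
    rw [ae_iff]
    simpa using toSphere_span_eq_zero v
  filter_upwards [hnull] with n hn
  refine mul_nonneg (abs_nonneg _) ?_
  by_cases hv : v = 0
  · simpa [hv] using indicator_nonneg (s := {(0 : Vel)}ᶜ) (f := (1 : Vel → ℝ)) (by simp) _
  have hpost : postVel α v w n ≠ 0 := by
    intro h
    set c := (1 + α) / 2 * inner ℝ (v - w) (n : Vel) with hc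
    have hvc : v = c • (n : Vel) := sub_eq_zero.1 h
    have hc0 : c ≠ 0 := by
      intro h0
      rw [h0, zero_smul] at hvc
      exact hv hvc
    refine hn (Submodule.mem_span_singleton.2 ⟨c⁻¹, ?_⟩)
    rw [hvc, inv_smul_smul₀ hc0]
  simp [hv, hpost]

lemma weakCollision_indicator_nonneg (α : ℝ) (μ : Measure Vel) :
    0 ≤ weakCollision α μ (indicator {0}ᶜ 1) :=
  integral_nonneg fun v => integral_nonneg fun w => angular_indicator_nonneg α v w

/-- The bump function equal to one on the ball of radius `r` and to zero off the ball of radius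
`2r`. -/
def centeredBump (r : ℝ) (hr : 0 < r) : ContDiffBump (0 : Vel) :=
  ⟨r, 2 * r, hr, by linarith⟩

/-- A smooth function with values in `[0, 1]`, equal to one for `2 / (k + 1) ≤ |v| ≤ k + 1` and to
zero at the origin and for large `|v|`. -/
def puncturedCutoff (k : ℕ) (v : Vel) : ℝ :=
  centeredBump (k + 1) (by positivity) v * (1 - centeredBump (1 / (k + 1)) (by positivity) v)

lemma contDiff_puncturedCutoff (k : ℕ) : ContDiff ℝ ∞ (puncturedCutoff k) :=
  (ContDiffBump.contDiff _).mul (contDiff_const.sub (ContDiffBump.contDiff _))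

lemma hasCompactSupport_puncturedCutoff (k : ℕ) : HasCompactSupport (puncturedCutoff k) :=
  (ContDiffBump.hasCompactSupport _).mul_right

lemma puncturedCutoff_mem_Icc (k : ℕ) (v : Vel) : puncturedCutoff k v ∈ Icc (0 : ℝ) 1 := by
  unfold puncturedCutoff
  set a := centeredBump (k + 1) (by positivity)
  set b := centeredBump (1 / (k + 1)) (by positivity)
  have hb : 0 ≤ 1 - b v := sub_nonneg.2 b.le_one
  exact ⟨mul_nonneg a.nonneg hb, mul_le_one₀ a.le_one hb (by linarith [b.nonneg (x := v)])⟩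

lemma tendsto_puncturedCutoff (v : Vel) :
    Tendsto (puncturedCutoff · v) atTop (𝓝 (indicator {0}ᶜ 1 v)) := by
  by_cases hv : v = 0
  · subst hv
    have h k : puncturedCutoff k 0 = 0 := by
      unfold puncturedCutoff
      rw [ContDiffBump.one_of_mem_closedBall (centeredBump (1 / (k + 1)) _)
        (Metric.mem_closedBall_self (ContDiffBump.rIn_pos _).le)]
      ring
    simp [h]
  refine tendsto_const_nhds.congr' ?_
  have hsmall : ∀ᶠ k : ℕ in atTop, (1 : ℝ) / (k + 1) < ‖v‖ / 2 :=
    tendsto_one_div_add_atTop_nhds_zero_nat.eventually_lt_const (by positivity)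
  filter_upwards [hsmall, eventually_ge_atTop ⌈‖v‖⌉₊] with k hk1 hk2
  unfold puncturedCutoff
  rw [ContDiffBump.one_of_mem_closedBall, ContDiffBump.zero_of_le_dist]
  · simp [hv]
  · rw [dist_zero_right]
    change 2 * (1 / ((k : ℝ) + 1)) ≤ ‖v‖
    linarith
  · rw [mem_closedBall_zero_iff]
    change ‖v‖ ≤ (k : ℝ) + 1
    have := Nat.ceil_le.1 hk2
    linarith

/-- The mass carried by nonzero velocities does not decrease: collisions do not feed an atom at the
origin. -/
lemma IsWeakSolution.real_compl_zero_le {α : ℝ} {f : ℝ → Measure Vel} (hf : IsWeakSolution α f)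
    {t : ℝ} (ht : 0 ≤ t) : (f 0).real {0}ᶜ ≤ (f t).real {0}ᶜ := by
  have h := hf.equation_of_tendsto contDiff_puncturedCutoff hasCompactSupport_puncturedCutoff
    puncturedCutoff_mem_Icc tendsto_puncturedCutoff ht
  have hm : MeasurableSet ({0}ᶜ : Set Vel) := (measurableSet_singleton 0).compl
  rw [integral_indicator_one hm, integral_indicator_one hm] at h
  have hQ : 0 ≤ ∫ τ in (0 : ℝ)..t, weakCollision α (f τ) (indicator {0}ᶜ 1) :=
    intervalIntegral.integral_nonneg ht fun τ _ => weakCollision_indicator_nonneg α (f τ)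
  linarith

lemma energy_pos {μ : Measure Vel} (hμ : μ {0}ᶜ ≠ 0) : 0 < energy μ := by
  rw [pos_iff_ne_zero]
  intro h
  rw [energy, lintegral_eq_zero_iff (by fun_prop)] at h
  refine hμ (measure_mono_null ?_ (ae_iff.1 h))
  intro v hv
  simpa using hv

lemma real_compl_zero_withDensity {f₀ : Vel → ℝ} (hf₀ : ∀ᵐ v, 0 ≤ f₀ v) (hmass : ∫ v, f₀ v = 1) :
    (volume.withDensity fun v => ENNReal.ofReal (f₀ v)).real {0}ᶜ = 1 := by
  have hint : Integrable f₀ := by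
    by_contra h
    simp [integral_undef h] at hmass
  have hae : ({0}ᶜ : Set Vel) =ᵐ[volume] univ := by
    rw [ae_eq_univ, compl_compl]
    exact measure_singleton 0
  rw [measureReal_def, withDensity_apply _ (measurableSet_singleton 0).compl,
    setLIntegral_congr hae, setLIntegral_univ, ← ofReal_integral_eq_lintegral_ofReal hint hf₀, hmass]
  simp

end InelasticBoltzmann

end

/-- Let `0 < α ≤ 1`, let `f₀ ≥ 0` be normalized and lie in `L^∞_s` for some `s > 2`. Then every weak
solution of the inelastic hard-sphere Boltzmann equation with initial datum `f₀ dv` has infinite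
cooling time (in both of the usual expressions for it). -/
theorem corollary1p2 (α : ℝ) (hα₀ : 0 < α) (hα₁ : α ≤ 1)
    (f₀ : InelasticBoltzmann.Vel → ℝ) (hf₀ : ∀ᵐ v, 0 ≤ f₀ v)
    (hnorm : InelasticBoltzmann.Normalized f₀)
    (s : ℝ) (hs : 2 < s) (hLs : InelasticBoltzmann.MemWeightedLp f₀ ⊤ s)
    (f : ℝ → Measure InelasticBoltzmann.Vel) (hf : InelasticBoltzmann.IsWeakSolution α f)
    (hinit : f 0 = volume.withDensity (fun v => ENNReal.ofReal (f₀ v))) :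
    InelasticBoltzmann.coolingTime f = ⊤ ∧ InelasticBoltzmann.coolingTime' f = ⊤ := by

  have hpos : ∀ t : ℝ, 0 ≤ t → 0 < InelasticBoltzmann.energy (f t) := by
    intro t ht
    refine InelasticBoltzmann.energy_pos fun h => ?_
    have h1 := hf.real_compl_zero_le ht
    rw [hinit, InelasticBoltzmann.real_compl_zero_withDensity hf₀ hnorm.mass, measureReal_def, h]
      at h1
    norm_num at h1
  constructor
  · have hempty : {T : ℝ | 0 ≤ T ∧ ∀ t : ℝ, T < t → InelasticBoltzmann.energy (f t) = 0} = ∅ := by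
      refine eq_empty_of_forall_notMem fun T hT => ?_
      exact (hpos (T + 1) (by linarith [hT.1])).ne' (hT.2 (T + 1) (by linarith))
    rw [InelasticBoltzmann.coolingTime, hempty, image_empty, sInf_empty]
  · refine ENNReal.eq_top_of_forall_nnreal_le fun r => ?_
    refine le_sSup ⟨r, ⟨r.2, fun t ht _ => hpos t ht⟩, ENNReal.ofReal_coe_nnreal⟩
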